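/- **Theorem (Darboux–Carathéodory).** Let $(M,\omega)$ be a smooth symplectic manifold of dimension $2n$ and let $F=(f_1,\dots,f_n):M\to\mathbb{R}^n$ be a smooth map such that $(M,\omega,F)$ is an integrable system: $\{f_i,f_j\}=0$ for all $i,j$, where $\{f,g\}=\omega(X_f,X_g)$ and $\omega(X_f,\cdot)=-\mathrm{d}f$, and $\mathrm{d}_pF$ is onto for almost every $p\in M$. Let $m\in M$ be a regular point, i.e. $\mathrm{d}_mF$ has rank $n$. On $\mathbb{R}^{2n}$ with coordinates $(x,\xi)=(x_1,\dots,x_n,\xi_1,\dots,\xi_n)$ put $\omega_{\mathrm{can}}=\sum_{i=1}^n\mathrm{d}\xi_i\wedge\mathrm{d}x_i$ and regard $\xi$ as a map $\mathbb{R}^{2n}\to\mathbb{R}^n$. 1. There exist open neighbourhoods $U\subset M$ of $m$ and $V\subset\mathbb{R}^{2n}$ of the origin such that $(U,\omega|_U,(F-F(m))|_U)$ is strongly symplectically equivalent to $(V,\omega_{\mathrm{can}}|_V,\xi|_V)$ via a pair of the form $(\varphi,\mathrm{id})$ with $\varphi(m)=0$. That is, $F(U)-F(m)=\xi(V)$,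 and there is a diffeomorphism $\varphi:U\to V$ with $\varphi(m)=0$, $\varphi^*(\omega_{\mathrm{can}}|_V)=\omega|_U$ and $\xi\circ\varphi=F-F(m)$ on $U$. 2. Equivalently, the functions $f_i-f_i(m)$ extend to local Darboux coordinates centred at $m$: there exist an open neighbourhood $U$ of $m$ and functions $x_1,\dots,x_n$ vanishing at $m$ such that $(x_1,\dots,x_n,f_1-f_1(m),\dots,f_n-f_n(m))$ is a smooth coordinate chart of $M$ with domain $U$, and $\omega=\sum_{i=1}^n\mathrm{d}f_i\wedge\mathrm{d}x_i$ on $U$. -/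

import Mathlib

open Set Function MeasureTheory TopologicalSpace
open scoped Manifold ContDiff

noncomputable section

namespace DarbouxCaratheodory

/-! ### Linear algebra of two-forms -/

/-- The wedge product `α ∧ β` of two covectors,
`(α ∧ β)(v, w) = α(v) β(w) - α(w) β(v)`. -/
def wedge {V : Type*} [AddCommGroup V] [Module ℝ V] [TopologicalSpace V]
    (α β : V →L[ℝ] ℝ) : V [⋀^Fin 2]→L[ℝ] ℝ where
  toFun v := α (v 0) * β (v 1) - α (v 1) * β (v 0)
  map_update_add' v i x y := by
    fin_cases i <;> simp <;> ring
  map_update_smul' v i c x := by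
    fin_cases i <;> simp <;> ring
  map_eq_zero_of_eq' v i j h hij := by
    fin_cases i <;> fin_cases j <;> simp_all
  cont := by fun_prop

theorem wedge_apply {V : Type*} [AddCommGroup V] [Module ℝ V] [TopologicalSpace V]
    (α β : V →L[ℝ] ℝ) (v w : V) : wedge α β ![v, w] = α v * β w - α w * β v := rfl

/-! ### Two-forms on `2n`-dimensional manifolds -/

/-- The model space `ℝ²ⁿ`. -/
abbrev R2 (n : ℕ) : Type := EuclideanSpace ℝ (Fin (2 * n))

/-- The space `ℝⁿ` of values of a system with `n` degrees of freedom. -/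
abbrev R1 (n : ℕ) : Type := EuclideanSpace ℝ (Fin n)

/-- A field of alternating bilinear forms on the tangent spaces of a `2n`-dimensional manifold
(no regularity is included). -/
abbrev TwoForm (n : ℕ) (M : Type*) [TopologicalSpace M] [ChartedSpace (R2 n) M] : Type _ :=
  (p : M) → TangentSpace (𝓡 (2 * n)) p [⋀^Fin 2]→L[ℝ] ℝ

/-- The pullback `f^* σ` of a two-form. -/
def pullback {n : ℕ} {M N : Type*} [TopologicalSpace M] [ChartedSpace (R2 n) M]
    [TopologicalSpace N] [ChartedSpace (R2 n) N] (f : M → N) (σ : TwoForm n N) : TwoForm n M :=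
  fun p => (σ (f p)).compContinuousLinearMap (mfderiv (𝓡 (2 * n)) (𝓡 (2 * n)) f p)

/-- The expression `(e⁻¹)^* σ` of a two-form in a chart `e`; it is meaningful on `e.target`. -/
def inChart {n : ℕ} {M : Type*} [TopologicalSpace M] [ChartedSpace (R2 n) M]
    (σ : TwoForm n M) (e : OpenPartialHomeomorph M (R2 n)) : R2 n → R2 n [⋀^Fin 2]→L[ℝ] ℝ :=
  fun y => pullback (n := n) (e.symm : R2 n → M) σ y

/-- A symplectic form: a smooth, closed, non-degenerate two-form. Smoothness and `dσ = 0` are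
expressed in the charts of the atlas. -/
structure IsSymplectic {n : ℕ} {M : Type*} [TopologicalSpace M] [ChartedSpace (R2 n) M]
    (σ : TwoForm n M) : Prop where
  smooth : ∀ e ∈ atlas (R2 n) M, ContDiffOn ℝ ∞ (inChart σ e) e.target
  closed : ∀ e ∈ atlas (R2 n) M, ∀ y ∈ e.target, extDeriv (inChart σ e) y = 0
  nondegenerate : ∀ (p : M) (v : TangentSpace (𝓡 (2 * n)) p),
    (∀ w : TangentSpace (𝓡 (2 * n)) p, σ p ![v, w] = 0) → v = 0

/-! ### Hamiltonian vector fields and Poisson brackets -/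

/-- The differential of a real function at a point, as a covector. -/
def differential {n : ℕ} {M : Type*} [TopologicalSpace M] [ChartedSpace (R2 n) M]
    (f : M → ℝ) (p : M) : TangentSpace (𝓡 (2 * n)) p →L[ℝ] ℝ :=
  mfderiv (𝓡 (2 * n)) 𝓘(ℝ, ℝ) f p

open scoped Classical in
/-- The Hamiltonian vector field `X_f`, determined by `σ(X_f, ·) = -df`
(see `hamiltonianVectorField_spec`). -/
def hamiltonianVectorField {n : ℕ} {M : Type*} [TopologicalSpace M] [ChartedSpace (R2 n) M]
    (σ : TwoForm n M) (f : M → ℝ) (p : M) : TangentSpace (𝓡 (2 * n)) p :=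
  if h : ∃ X : TangentSpace (𝓡 (2 * n)) p,
      ∀ v : TangentSpace (𝓡 (2 * n)) p, σ p ![X, v] = -differential (n := n) f p v
  then h.choose else 0

/-- The Poisson bracket `{f, g} = σ(X_f, X_g)`. -/
def poissonBracket {n : ℕ} {M : Type*} [TopologicalSpace M] [ChartedSpace (R2 n) M]
    (σ : TwoForm n M) (f g : M → ℝ) : M → ℝ :=
  fun p => σ p ![hamiltonianVectorField σ f p, hamiltonianVectorField σ g p]

/-- For a non-degenerate form on a finite-dimensional space, every covector is `σ(X, ·)`. -/
theorem exists_contract_eq {V : Type*} [AddCommGroup V] [Module ℝ V] [TopologicalSpace V]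
    [FiniteDimensional ℝ V] (σ : V [⋀^Fin 2]→L[ℝ] ℝ)
    (hσ : ∀ v : V, (∀ w : V, σ ![v, w] = 0) → v = 0) (α : V →ₗ[ℝ] ℝ) :
    ∃ X : V, ∀ v : V, σ ![X, v] = α v := by
  have e0 : ∀ a w x : V, Function.update ![a, w] 0 x = ![x, w] := fun a w x => by
    ext i; fin_cases i <;> simp
  have e1 : ∀ a w x : V, Function.update ![a, w] 1 x = ![a, x] := fun a w x => by
    ext i; fin_cases i <;> simp
  have hadd0 : ∀ a b w : V, σ ![a + b, w] = σ ![a, w] + σ ![b, w] := fun a b w => by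
    have h := σ.map_update_add ![a, w] 0 a b
    rwa [e0, e0, e0] at h
  have hsmul0 : ∀ (c : ℝ) (a w : V), σ ![c • a, w] = c • σ ![a, w] := fun c a w => by
    have h := σ.map_update_smul ![a, w] 0 c a
    rwa [e0, e0] at h
  have hadd1 : ∀ v a b : V, σ ![v, a + b] = σ ![v, a] + σ ![v, b] := fun v a b => by
    have h := σ.map_update_add ![v, a] 1 a b
    rwa [e1, e1, e1] at h
  have hsmul1 : ∀ (c : ℝ) (v a : V), σ ![v, c • a] = c • σ ![v, a] := fun c v a => by
    have h := σ.map_update_smul ![v, a] 1 c a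
    rwa [e1, e1] at h
  let B : V →ₗ[ℝ] V →ₗ[ℝ] ℝ :=
    LinearMap.mk₂ ℝ (fun v w => σ ![v, w]) hadd0 hsmul0 hadd1 hsmul1
  have hinj : Function.Injective B := by
    rw [← LinearMap.ker_eq_bot, LinearMap.ker_eq_bot']
    intro v hv
    exact hσ v fun w => congrArg (fun l : V →ₗ[ℝ] ℝ => l w) hv
  have hsurj : Function.Surjective B :=
    (LinearMap.injective_iff_surjective_of_finrank_eq_finrank
      (Subspace.dual_finrank_eq (K := ℝ) (V := V)).symm).1 hinj
  obtain ⟨X, hX⟩ := hsurj α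
  exact ⟨X, fun v => congrArg (fun l : V →ₗ[ℝ] ℝ => l v) hX⟩

/-- The defining equation of the Hamiltonian vector field. -/
theorem hamiltonianVectorField_spec {n : ℕ} {M : Type*} [TopologicalSpace M]
    [ChartedSpace (R2 n) M] {σ : TwoForm n M} (hσ : IsSymplectic σ) (f : M → ℝ) (p : M)
    (v : TangentSpace (𝓡 (2 * n)) p) :
    σ p ![hamiltonianVectorField σ f p, v] = -differential (n := n) f p v := by
  have : FiniteDimensional ℝ (TangentSpace (𝓡 (2 * n)) p) :=
    inferInstanceAs (FiniteDimensional ℝ (R2 n))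
  have h : ∃ X : TangentSpace (𝓡 (2 * n)) p,
      ∀ v : TangentSpace (𝓡 (2 * n)) p, σ p ![X, v] = -differential (n := n) f p v :=
    exists_contract_eq (σ p) (hσ.nondegenerate p)
      (-(differential (n := n) f p : TangentSpace (𝓡 (2 * n)) p →ₗ[ℝ] ℝ))
  rw [hamiltonianVectorField, dif_pos h]
  exact h.choose_spec v

/-! ### Integrable systems -/

/-- A point is regular for `F` when the differential of `F` there is onto `ℝⁿ`, i.e. has rank
`n`. -/
def IsRegularPoint {n : ℕ} {M : Type*} [TopologicalSpace M] [ChartedSpace (R2 n) M]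
    (F : M → R1 n) (p : M) : Prop :=
  Surjective (mfderiv (𝓡 (2 * n)) (𝓡 n) F p)

/-- `(M, σ, F)` is an integrable system with `n` degrees of freedom. "Almost everywhere" refers
to the Lebesgue measure class of the charts. -/
structure IsIntegrableSystem {n : ℕ} {M : Type*} [TopologicalSpace M] [ChartedSpace (R2 n) M]
    (σ : TwoForm n M) (F : M → R1 n) : Prop where
  symplectic : IsSymplectic σ
  smooth : ContMDiff (𝓡 (2 * n)) (𝓡 n) ∞ F
  involution : ∀ (i j : Fin n) (p : M),
    poissonBracket σ (fun q => F q i) (fun q => F q j) p = 0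
  independent : ∀ e ∈ atlas (R2 n) M,
    volume (e '' (e.source ∩ {p | ¬ IsRegularPoint F p})) = 0

/-- The restriction `σ|_U` to an open subset. -/
def restrictForm {n : ℕ} {M : Type*} [TopologicalSpace M] [ChartedSpace (R2 n) M]
    (σ : TwoForm n M) (U : Opens M) : TwoForm n U :=
  pullback (Subtype.val : U → M) σ

/-- The restriction `F|_U` to an open subset. -/
def restrictMap {n : ℕ} {M : Type*} [TopologicalSpace M] (F : M → R1 n) (U : Opens M) :
    U → R1 n :=
  fun p => F p

/-- Smoothness of a map defined on an arbitrary subset `A ⊆ ℝⁿ`: local smooth extendability. -/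
def IsSmoothOnSubset {n : ℕ} {A : Set (R1 n)} (h : A → R1 n) : Prop :=
  ∀ a : A, ∃ (W : Set (R1 n)) (k : R1 n → R1 n),
    IsOpen W ∧ (a : R1 n) ∈ W ∧ ContDiffOn ℝ ∞ k W ∧ ∀ b : A, (b : R1 n) ∈ W → k b = h b

/-- The pair `(φ, g)` is a strong symplectic equivalence from `(M, σ, F)` to `(N, η, G)`:
`φ` is a symplectomorphism, `g : F(M) → G(N)` is a diffeomorphism, and `G ∘ φ = g ∘ F`. -/
structure IsStrongSymplecticEquivalence {n : ℕ} {M N : Type*}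
    [TopologicalSpace M] [ChartedSpace (R2 n) M] [TopologicalSpace N] [ChartedSpace (R2 n) N]
    (σ : TwoForm n M) (F : M → R1 n) (η : TwoForm n N) (G : N → R1 n)
    (φ : M ≃ₘ^∞⟮𝓡 (2 * n), 𝓡 (2 * n)⟯ N) (g : range F ≃ range G) : Prop where
  symplectomorphism : pullback (n := n) φ η = σ
  smooth : IsSmoothOnSubset (fun a => (g a : R1 n))
  smooth_symm : IsSmoothOnSubset (fun b => (g.symm b : R1 n))
  commutes : ∀ p : M, G (φ p) = g ⟨F p, mem_range_self p⟩

/-! ### The standard system on `ℝ²ⁿ`, and Darboux coordinates -/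

/-- The position of the coordinate `x_i` among the coordinates `(x_1, …, x_n, ξ_1, …, ξ_n)`. -/
def xIndex {n : ℕ} (i : Fin n) : Fin (2 * n) := ⟨i, by omega⟩

/-- The position of the coordinate `ξ_i` among the coordinates `(x_1, …, x_n, ξ_1, …, ξ_n)`. -/
def xiIndex {n : ℕ} (i : Fin n) : Fin (2 * n) := ⟨n + i, by omega⟩

/-- The canonical symplectic form `σ_can = ∑ i, dξ_i ∧ dx_i` on `ℝ²ⁿ`. -/
def canonicalForm (n : ℕ) : TwoForm n (R2 n) :=
  fun p => ∑ i : Fin n,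
    wedge (differential (n := n) (fun q : R2 n => q (xiIndex i)) p)
      (differential (n := n) (fun q : R2 n => q (xIndex i)) p)

/-- The map `ξ = (ξ_1, …, ξ_n) : ℝ²ⁿ → ℝⁿ`. -/
def xiMap (n : ℕ) : R2 n → R1 n :=
  fun q => WithLp.toLp 2 fun i => q (xiIndex i)

/-- The functions `(x_1, …, x_n, ξ_1, …, ξ_n)` restrict to Darboux coordinates on the open
neighbourhood `U` of `m`, centred at `m`: they are the components of a smooth chart with domain
`U` that maps `m` to the origin, and `σ = ∑ i, dξ_i ∧ dx_i` on `U`. -/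
def IsDarbouxCoordinates {n : ℕ} {M : Type*} [TopologicalSpace M] [ChartedSpace (R2 n) M]
    (σ : TwoForm n M) (m : M) (U : Opens M) (x ξ : Fin n → M → ℝ) : Prop :=
  m ∈ U ∧
  (∃ e ∈ IsManifold.maximalAtlas (𝓡 (2 * n)) ∞ M, e.source = (U : Set M) ∧ e m = 0 ∧
    ∀ p ∈ U, ∀ i : Fin n, e p (xIndex i) = x i p ∧ e p (xiIndex i) = ξ i p) ∧
  ∀ p ∈ U, σ p = ∑ i : Fin n,
    wedge (differential (n := n) (ξ i) p) (differential (n := n) (x i) p)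

end DarbouxCaratheodory

end

/-! Choose coordinates near `m` in which `F - F(m)` becomes `ξ`. This is possible by the inverse
function theorem, since the differential of `F` at `m` is onto. The Hamiltonian vectors of the `n`
components then span an `n`-dimensional space. Involution puts this span inside the common kernel of
the differentials, which also has dimension `n`, so the two agree and the fibres `ξ = const` are
isotropic (`isotropic_ker_of_involution`).

What remains is a Poincaré lemma relative to this fibration (`exists_conjugate_coordinates`). Let
`Q` be the projection that kills the coordinates `x`. The homotopy operator for `Q + t (1 - Q)`
(`exists_primitive_sub`) contracts the form `B` with a vector tangent to the fibre. By isotropy its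
primitive `θ₁` of `B - Q^*B` therefore vanishes on the fibres. The section `x = 0` need not be
Lagrangian, so `Q^*B` may be non-zero. It is exact by the ordinary Poincaré lemma, with a primitive
`Q^*θ₀` that also vanishes on the fibres. Hence `B = d(∑ β_i dξ_i) = ∑ dξ_i ∧ d(-β_i)`, and the
conjugate coordinates are the functions `-β_i`, up to constants.

Non-degeneracy of the form makes `(-β, ξ)` a local diffeomorphism. Composing with a chart at `m`
gives a single chart (`exists_darboux_chart`) from which both formulations are read off. The
homotopy operator is an integral over `[0, 1]`, so its smoothness rests on `contDiffOn_integral`. -/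

noncomputable section

namespace DarbouxCaratheodory

/-! ### Smoothness of parametric integrals -/

/-- Differentiation under the integral sign for a `C¹` integrand. -/
theorem hasFDerivAt_integral_of_contDiffOn {E F : Type} [NormedAddCommGroup E] [NormedSpace ℝ E]
    [FiniteDimensional ℝ E] [NormedAddCommGroup F] [NormedSpace ℝ F]
    {O : Set (ℝ × E)} (hO : IsOpen O) {W : Set E} (hW : IsOpen W)
    (hWO : ∀ t ∈ Icc (0 : ℝ) 1, ∀ x ∈ W, (t, x) ∈ O)
    {g : ℝ × E → F} (hg : ContDiffOn ℝ 1 g O) {x₀ : E} (hx₀ : x₀ ∈ W) :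
    HasFDerivAt (fun x => ∫ t in (0 : ℝ)..1, g (t, x))
      (∫ t in (0 : ℝ)..1, (fderiv ℝ g (t, x₀)).comp (ContinuousLinearMap.inr ℝ ℝ E)) x₀ := by
  obtain ⟨r, hr, hrW⟩ := Metric.isOpen_iff.1 hW x₀ hx₀
  have hK : IsCompact (Icc (0 : ℝ) 1 ×ˢ Metric.closedBall x₀ (r / 2)) :=
    isCompact_Icc.prod (isCompact_closedBall x₀ (r / 2))
  have hball : Metric.closedBall x₀ (r / 2) ⊆ W :=
    (Metric.closedBall_subset_ball (by linarith)).trans hrW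
  have hKO : Icc (0 : ℝ) 1 ×ˢ Metric.closedBall x₀ (r / 2) ⊆ O :=
    fun q hq => hWO q.1 hq.1 q.2 (hball hq.2)
  set D : ℝ × E → E →L[ℝ] F :=
    fun q => (fderiv ℝ g q).comp (ContinuousLinearMap.inr ℝ ℝ E) with hD
  -- The partial derivative is continuous, hence bounded on the compact set `[0, 1] × closedBall x₀
  -- (r / 2)`. The bound is the constant dominating function.
  have hDc : ContinuousOn D O :=
    (hg.continuousOn_fderiv_of_isOpen hO le_rfl).clm_comp continuousOn_const
  obtain ⟨C, hC⟩ := hK.exists_bound_of_continuousOn (hDc.mono hKO)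
  have hI : uIoc (0 : ℝ) 1 ⊆ Icc 0 1 := by
    rw [uIoc_of_le zero_le_one]; exact Ioc_subset_Icc_self
  have hline : ∀ x ∈ W, ContinuousOn (fun t : ℝ => (t, x)) (Icc (0 : ℝ) 1) :=
    fun x _ => by fun_prop
  have hgt : ∀ x ∈ W, ContinuousOn (fun t : ℝ => g (t, x)) (Icc (0 : ℝ) 1) := fun x hx =>
    hg.continuousOn.comp (hline x hx) fun t ht => hWO t ht x hx
  have hDt : ∀ x ∈ W, ContinuousOn (fun t : ℝ => D (t, x)) (Icc (0 : ℝ) 1) := fun x hx =>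
    hDc.comp (hline x hx) fun t ht => hWO t ht x hx
  have hmem : Metric.ball x₀ (r / 2) ∈ nhds x₀ := Metric.ball_mem_nhds x₀ (by linarith)
  refine intervalIntegral.hasFDerivAt_integral_of_dominated_of_fderiv_le
    (F := fun x t => g (t, x)) (F' := fun x t => D (t, x)) (bound := fun _ => C) hmem ?_ ?_ ?_ ?_
    intervalIntegrable_const ?_
  · filter_upwards [hW.mem_nhds hx₀] with x hx
    exact ((hgt x hx).mono hI).aestronglyMeasurable measurableSet_uIoc
  · exact ((hgt x₀ hx₀).mono (by rw [uIcc_of_le zero_le_one])).intervalIntegrable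
  · exact ((hDt x₀ hx₀).mono hI).aestronglyMeasurable measurableSet_uIoc
  · exact Filter.Eventually.of_forall fun t ht x hx =>
      hC (t, x) ⟨hI ht, Metric.ball_subset_closedBall hx⟩
  · refine Filter.Eventually.of_forall fun t ht x hx => ?_
    have h1 : HasFDerivAt g (fderiv ℝ g (t, x)) (t, x) :=
      ((hg.differentiableOn one_ne_zero).differentiableAt (hO.mem_nhds
        (hKO ⟨hI ht, Metric.ball_subset_closedBall hx⟩))).hasFDerivAt
    exact h1.comp x (hasFDerivAt_prodMk_right t x)

/-- The integral of a smooth family of functions is smooth. -/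
theorem contDiffOn_integral {E : Type} [NormedAddCommGroup E] [NormedSpace ℝ E]
    [FiniteDimensional ℝ E] {O : Set (ℝ × E)} (hO : IsOpen O) {W : Set E} (hW : IsOpen W)
    (hWO : ∀ t ∈ Icc (0 : ℝ) 1, ∀ x ∈ W, (t, x) ∈ O) (k : ℕ) :
    ∀ {F : Type} [NormedAddCommGroup F] [NormedSpace ℝ F] {g : ℝ × E → F},
      ContDiffOn ℝ ∞ g O → ContDiffOn ℝ k (fun x => ∫ t in (0 : ℝ)..1, g (t, x)) W := by
  -- The target space varies in the induction: the derivative is again a parametric integral, with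
  -- values in `E →L[ℝ] F`.
  induction k with
  | zero =>
    intro F _ _ g hg
    exact contDiffOn_zero.2 fun x hx => (hasFDerivAt_integral_of_contDiffOn hO hW hWO
      (hg.of_le (by exact_mod_cast le_top)) hx).continuousAt.continuousWithinAt
  | succ k ih =>
    intro F _ _ g hg
    have hd := fun x (hx : x ∈ W) => hasFDerivAt_integral_of_contDiffOn hO hW hWO
      (hg.of_le (by exact_mod_cast le_top)) hx
    rw [Nat.cast_succ, contDiffOn_succ_iff_fderiv_of_isOpen hW]
    refine ⟨fun x hx => (hd x hx).differentiableAt.differentiableWithinAt, by simp, ?_⟩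
    have h : ContDiffOn ℝ ∞
        (fun q => (fderiv ℝ g q).comp (ContinuousLinearMap.inr ℝ ℝ E)) O :=
      (hg.fderiv_of_isOpen hO (by simp)).clm_comp contDiffOn_const
    exact (ih h).congr fun x hx => (hd x hx).fderiv

/-! ### The homotopy operator on two-forms -/

/-- An alternating two-form as a bilinear map. -/
def curryForm (E : Type) [NormedAddCommGroup E] [NormedSpace ℝ E] :
    (E [⋀^Fin 2]→L[ℝ] ℝ) →L[ℝ] E →L[ℝ] E →L[ℝ] ℝ :=
  (ContinuousLinearMap.compL ℝ E (E [⋀^Fin 1]→L[ℝ] ℝ) (E →L[ℝ] ℝ)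
    ((ContinuousAlternatingMap.ofSubsingletonLIE (𝕜 := ℝ) (E := E) (F := ℝ)
      (0 : Fin 1)).symm.toContinuousLinearEquiv :
      _ →L[ℝ] _)).comp
  (ContinuousAlternatingMap.curryLeftLI (𝕜 := ℝ) (E := E) (F := ℝ) (n := 1)).toContinuousLinearMap

theorem curryForm_apply {E : Type} [NormedAddCommGroup E] [NormedSpace ℝ E]
    (τ : E [⋀^Fin 2]→L[ℝ] ℝ) (a b : E) : curryForm E τ a b = τ ![a, b] := by
  have e : (Matrix.vecCons a fun _ : Fin 1 => b) = ![a, b] := by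
    ext i; fin_cases i <;> rfl
  simp [curryForm, e]

theorem form_swap {E : Type*} [AddCommGroup E] [Module ℝ E] [TopologicalSpace E]
    (τ : E [⋀^Fin 2]→L[ℝ] ℝ) (a b : E) : τ ![a, b] = - τ ![b, a] := by
  have h := τ.map_swap ![b, a] (i := 0) (j := 1) (by decide)
  have e : ![b, a] ∘ Equiv.swap (0 : Fin 2) 1 = ![a, b] := by
    ext i; fin_cases i <;> simp
  rwa [e] at h

/-- Closedness of a two-form in terms of the associated bilinear maps. -/
theorem fderiv_curryForm_cyclic {E : Type} [NormedAddCommGroup E] [NormedSpace ℝ E]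
    {τ : E → E [⋀^Fin 2]→L[ℝ] ℝ} {x : E} (hτ : DifferentiableAt ℝ τ x) (h : extDeriv τ x = 0)
    (u v w : E) :
    fderiv ℝ (fun y => curryForm E (τ y)) x u v w =
      fderiv ℝ (fun y => curryForm E (τ y)) x v u w -
        fderiv ℝ (fun y => curryForm E (τ y)) x w u v := by
  have hc : HasFDerivAt (fun η => curryForm E η) (curryForm E) (τ x) :=
    ContinuousLinearMap.hasFDerivAt _
  have hd : HasFDerivAt (fun y => curryForm E (τ y)) ((curryForm E).comp (fderiv ℝ τ x)) x :=
    HasFDerivAt.comp (F := E [⋀^Fin 2]→L[ℝ] ℝ) (G := E →L[ℝ] E →L[ℝ] ℝ) x hc hτ.hasFDerivAt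
  have h1 := congrArg (fun η => η ![u, v, w]) h
  simp only [extDeriv, ContinuousAlternatingMap.alternatizeUncurryFin_apply] at h1
  have h2 := Fin.sum_univ_three fun i : Fin 3 =>
    (-1 : ℤ) ^ (i : ℕ) • (fderiv ℝ τ x) (![u, v, w] i) (i.removeNth ![u, v, w])
  have e0 : Fin.removeNth 0 ![u, v, w] = ![v, w] := by
    ext i; fin_cases i <;> rfl
  have e1 : Fin.removeNth 1 ![u, v, w] = ![u, w] := by
    ext i; fin_cases i <;> rfl
  have e2 : Fin.removeNth 2 ![u, v, w] = ![u, v] := by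
    ext i; fin_cases i <;> rfl
  rw [e0, e1, e2] at h2
  have h3 := h2.symm.trans h1
  simp only [hd.fderiv, ContinuousLinearMap.comp_apply, curryForm_apply]
  simp at h3
  linarith

/-- Product rule in the space variable for the integrand of the homotopy operator, with the last
slot frozen. -/
theorem hasFDerivAt_bilin_comp {E : Type} [NormedAddCommGroup E] [NormedSpace ℝ E]
    {B : E → E →L[ℝ] E →L[ℝ] ℝ} {A P : E →L[ℝ] E} {x : E} (hB : DifferentiableAt ℝ B (A x))
    (c : E) :
    HasFDerivAt (fun z => B (A z) (P z) c)
      ((((fderiv ℝ B (A x)).comp A).flip (P x)).flip c + ((B (A x)).flip c).comp P) x := by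
  have h1 : HasFDerivAt (fun z => B (A z)) ((fderiv ℝ B (A x)).comp A) x :=
    HasFDerivAt.comp (g := B) (g' := fderiv ℝ B (A x)) x hB.hasFDerivAt A.hasFDerivAt
  have h2 := (h1.clm_apply P.hasFDerivAt).clm_apply (hasFDerivAt_const c x)
  refine h2.congr_fderiv ?_
  ext v
  simp [add_comm]

/-- Product rule in the time variable, used for `t ↦ B (A_t x) (A_t a) (A_t b)`. -/
theorem hasDerivAt_bilin_comp {E : Type} [NormedAddCommGroup E] [NormedSpace ℝ E]
    {B : E → E →L[ℝ] E →L[ℝ] ℝ} {u v w : ℝ → E} {u' v' w' : E} {t : ℝ}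
    (hB : DifferentiableAt ℝ B (u t)) (hu : HasDerivAt u u' t) (hv : HasDerivAt v v' t)
    (hw : HasDerivAt w w' t) :
    HasDerivAt (fun s => B (u s) (v s) (w s))
      (fderiv ℝ B (u t) u' (v t) (w t) + B (u t) v' (w t) + B (u t) (v t) w') t := by
  have h1 : HasDerivAt (fun s => B (u s)) (fderiv ℝ B (u t) u') t :=
    HasFDerivAt.comp_hasDerivAt (l := B) (l' := fderiv ℝ B (u t)) t hB.hasFDerivAt hu
  exact (h1.clm_apply hv).clm_apply hw

/-- The homotopy operator: if `B` is a closed two-form on `W` and `A_t = Q + t (1 - Q)` preserves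
`W` for `t ∈ [0, 1]`, then `B` and its pullback under `Q` differ by an exact form. -/
theorem exists_primitive_sub {E : Type} [NormedAddCommGroup E] [NormedSpace ℝ E]
    [FiniteDimensional ℝ E] {W : Set E} (hW : IsOpen W) {B : E → E →L[ℝ] E →L[ℝ] ℝ}
    (hB : ContDiffOn ℝ ∞ B W) (halt : ∀ x ∈ W, ∀ a b, B x a b = - B x b a)
    (hclosed : ∀ x ∈ W, ∀ u v w,
      fderiv ℝ B x u v w = fderiv ℝ B x v u w - fderiv ℝ B x w u v)
    (Q : E →L[ℝ] E) (hQ : ∀ t ∈ Icc (0 : ℝ) 1, ∀ x ∈ W, Q x + t • (x - Q x) ∈ W) :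
    ∃ θ : E → E →L[ℝ] ℝ, ContDiffOn ℝ ∞ θ W ∧
      (∀ x v, (∀ t ∈ Icc (0 : ℝ) 1,
        B (Q x + t • (x - Q x)) (x - Q x) (Q v + t • (v - Q v)) = 0) → θ x v = 0) ∧
      ∀ x ∈ W, ∀ a b, fderiv ℝ θ x a b - fderiv ℝ θ x b a = B x a b - B (Q x) (Q a) (Q b) := by
  set P : E →L[ℝ] E := ContinuousLinearMap.id ℝ E - Q with hP
  have hPa : ∀ x, x - Q x = P x := fun x => by simp [hP]
  simp only [hPa] at hQ ⊢
  set A : ℝ → E →L[ℝ] E := fun t => Q + t • P with hA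
  have hAa : ∀ t x, Q x + t • P x = A t x := fun t x => by simp [hA]
  simp only [hAa] at hQ ⊢
  have hAs : ContDiff ℝ ∞ fun q : ℝ × E => A q.1 := by
    simp only [hA]; fun_prop
  have hAx : ContDiff ℝ ∞ fun q : ℝ × E => A q.1 q.2 := hAs.clm_apply contDiff_snd
  set O : Set (ℝ × E) := {q | A q.1 q.2 ∈ W} with hOdef
  have hO : IsOpen O := hW.preimage hAx.continuous
  have hWO : ∀ t ∈ Icc (0 : ℝ) 1, ∀ x ∈ W, (t, x) ∈ O := hQ
  -- `P x` is the velocity of `t ↦ A_t x`. The integrand is `B` contracted with this velocity and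
  -- pulled back along `A_t`, as in Cartan's formula.
  set g : ℝ × E → E →L[ℝ] ℝ := fun q => (B (A q.1 q.2) (P q.2)).comp (A q.1) with hg
  have hBA : ContDiffOn ℝ ∞ (fun q : ℝ × E => B (A q.1 q.2)) O :=
    hB.comp hAx.contDiffOn fun q hq => hq
  have hgs : ContDiffOn ℝ ∞ g O :=
    (hBA.clm_apply (P.contDiff.comp contDiff_snd).contDiffOn).clm_comp hAs.contDiffOn
  have hcont : ∀ {G : Type} [NormedAddCommGroup G] [NormedSpace ℝ G] {k : ℝ × E → G},
      ContinuousOn k O → ∀ x ∈ W, IntervalIntegrable (fun t => k (t, x)) volume 0 1 :=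
    fun hk x hx => ContinuousOn.intervalIntegrable <| by
      rw [uIcc_of_le zero_le_one]
      exact hk.comp (by fun_prop) fun t ht => hWO t ht x hx
  refine ⟨fun x => ∫ t in (0 : ℝ)..1, g (t, x),
    contDiffOn_infty.2 fun k => contDiffOn_integral hO hW hWO k hgs, ?_, ?_⟩
  · intro x v h
    by_cases hi : IntervalIntegrable (fun t => g (t, x)) volume 0 1
    · rw [ContinuousLinearMap.intervalIntegral_apply hi]
      refine intervalIntegral.integral_zero_ae (Filter.Eventually.of_forall fun t ht => ?_)
      rw [uIoc_of_le zero_le_one] at ht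
      exact h t (Ioc_subset_Icc_self ht)
    -- A non-integrable integrand has integral `0` by convention, so the vanishing clause holds even
    -- outside `W`.
    · beta_reduce
      rw [intervalIntegral.integral_undef hi, zero_apply]
  intro x hx a b
  have hg1 : ContDiffOn ℝ 1 g O := hgs.of_le (by exact_mod_cast le_top)
  rw [(hasFDerivAt_integral_of_contDiffOn hO hW hWO hg1 hx).fderiv]
  set D : ℝ × E → E →L[ℝ] E →L[ℝ] ℝ :=
    fun q => (fderiv ℝ g q).comp (ContinuousLinearMap.inr ℝ ℝ E) with hD
  have hDc : ContinuousOn D O :=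
    (hg1.continuousOn_fderiv_of_isOpen hO le_rfl).clm_comp continuousOn_const
  have hDa : ∀ v : E, ContinuousOn (fun q => D q v) O := fun v => hDc.clm_apply continuousOn_const
  have hDab : ∀ v w : E, ContinuousOn (fun q => D q v w) O :=
    fun v w => (hDa v).clm_apply continuousOn_const
  have hA0 : A 0 = Q := by simp [hA]
  have hA1 : A 1 = ContinuousLinearMap.id ℝ E := by simp [hA, hP]
  have hBd : ∀ t ∈ Icc (0 : ℝ) 1, DifferentiableAt ℝ B (A t x) := fun t ht =>
    (hB.differentiableOn (by simp)).differentiableAt (hW.mem_nhds (hWO t ht x hx))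
  have hval : ∀ t ∈ Icc (0 : ℝ) 1, ∀ v w, D (t, x) v w =
      fderiv ℝ B (A t x) (A t v) (P x) (A t w) + B (A t x) (P v) (A t w) := by
    intro t ht v w
    have h1 : HasFDerivAt (fun z => g (t, z)) (D (t, x)) x :=
      ((hg1.differentiableOn one_ne_zero).differentiableAt
        (hO.mem_nhds (hWO t ht x hx))).hasFDerivAt.comp x (hasFDerivAt_prodMk_right t x)
    have h2 := h1.clm_apply (hasFDerivAt_const w x)
    have h3 := hasFDerivAt_bilin_comp (P := P) (hBd t ht) (A t w)
    have h4 := congrArg (fun l : E →L[ℝ] ℝ => l v) (h2.unique h3)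
    simpa using h4
  have hderiv : ∀ t ∈ uIcc (0 : ℝ) 1, HasDerivAt (fun t => B (A t x) (A t a) (A t b))
      (D (t, x) a b - D (t, x) b a) t := by
    intro t ht
    rw [uIcc_of_le zero_le_one] at ht
    have hAd : ∀ v, HasDerivAt (fun t => A t v) (P v) t := fun v => by
      have := ((hasDerivAt_id t).smul_const (P v)).const_add (Q v)
      simpa [hA] using this
    have h3 := hasDerivAt_bilin_comp (hBd t ht) (hAd x) (hAd a) (hAd b)
    refine h3.congr_deriv ?_
    rw [hval t ht, hval t ht]
    -- Closedness trades the derivative of `B` along the velocity `P x` for the two derivatives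
    -- along `A_t a` and `A_t b` that occur in `dθ`.
    have hc := hclosed _ (hWO t ht x hx) (P x) (A t a) (A t b)
    have hs := halt _ (hWO t ht x hx) (A t a) (P b)
    rw [hc, hs]
    ring
  have hftc := intervalIntegral.integral_eq_sub_of_hasDerivAt hderiv
    (hcont ((hDab a b).sub (hDab b a)) x hx)
  rw [ContinuousLinearMap.intervalIntegral_apply (hcont (k := D) hDc x hx),
    ContinuousLinearMap.intervalIntegral_apply (hcont (k := D) hDc x hx),
    ContinuousLinearMap.intervalIntegral_apply (hcont (hDa a) x hx),
    ContinuousLinearMap.intervalIntegral_apply (hcont (hDa b) x hx),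
    ← intervalIntegral.integral_sub (hcont (hDab a b) x hx) (hcont (hDab b a) x hx), hftc]
  simp [hA0, hA1]

/-! ### Splitting `ℝ²ⁿ` -/

/-- The coordinates `(x_1, …, x_n)` of a vector of `ℝ²ⁿ`. -/
def xPart (n : ℕ) : R2 n →L[ℝ] (Fin n → ℝ) :=
  ContinuousLinearMap.pi fun i => EuclideanSpace.proj (xIndex i)

/-- The coordinates `(ξ_1, …, ξ_n)` of a vector of `ℝ²ⁿ`. -/
def xiPart (n : ℕ) : R2 n →L[ℝ] (Fin n → ℝ) :=
  ContinuousLinearMap.pi fun i => EuclideanSpace.proj (xiIndex i)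

@[simp] theorem xPart_apply {n : ℕ} (v : R2 n) (i : Fin n) : xPart n v i = v (xIndex i) := rfl

@[simp] theorem xiPart_apply {n : ℕ} (v : R2 n) (i : Fin n) : xiPart n v i = v (xiIndex i) := rfl

/-- The vector of `ℝ²ⁿ` with prescribed coordinates `x` and `ξ`. -/
def combine (n : ℕ) : ((Fin n → ℝ) × (Fin n → ℝ)) →L[ℝ] R2 n :=
  LinearMap.toContinuousLinearMap
    { toFun := fun p => WithLp.toLp 2 fun k : Fin (2 * n) =>
        if h : (k : ℕ) < n then p.1 ⟨k, h⟩ else p.2 ⟨k - n, by omega⟩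
      map_add' := fun p q => by
        ext k
        by_cases h : (k : ℕ) < n <;> simp [h]
      map_smul' := fun c p => by
        ext k
        by_cases h : (k : ℕ) < n <;> simp [h] }

@[simp] theorem xPart_combine {n : ℕ} (p : (Fin n → ℝ) × (Fin n → ℝ)) :
    xPart n (combine n p) = p.1 := by
  ext i
  simp [combine, xIndex]

@[simp] theorem xiPart_combine {n : ℕ} (p : (Fin n → ℝ) × (Fin n → ℝ)) :
    xiPart n (combine n p) = p.2 := by
  ext i
  simp [combine, xiIndex]

theorem combine_zero {n : ℕ} : combine n (0, 0) = 0 := map_zero _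

theorem index_cases {n : ℕ} (k : Fin (2 * n)) :
    (∃ i : Fin n, k = xIndex i) ∨ ∃ i : Fin n, k = xiIndex i := by
  by_cases h : (k : ℕ) < n
  · exact Or.inl ⟨⟨k, h⟩, rfl⟩
  · exact Or.inr ⟨⟨k - n, by omega⟩, Fin.ext (by simp [xiIndex]; omega)⟩

theorem R2_ext {n : ℕ} {v w : R2 n} (hx : xPart n v = xPart n w) (hξ : xiPart n v = xiPart n w) :
    v = w := by
  ext k
  rcases index_cases k with ⟨i, rfl⟩ | ⟨i, rfl⟩
  · exact congrFun hx i
  · exact congrFun hξ i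

/-- The projection of `ℝ²ⁿ` that kills the coordinates `x`. -/
def xiProj (n : ℕ) : R2 n →L[ℝ] R2 n :=
  (combine n).comp ((ContinuousLinearMap.inr ℝ (Fin n → ℝ) (Fin n → ℝ)).comp (xiPart n))

@[simp] theorem xPart_xiProj {n : ℕ} (v : R2 n) : xPart n (xiProj n v) = 0 := by
  simp [xiProj]

@[simp] theorem xiPart_xiProj {n : ℕ} (v : R2 n) : xiPart n (xiProj n v) = xiPart n v := by
  simp [xiProj]

/-- Balls around the origin are therefore stable under `xiProj`, and by convexity under the whole
homotopy to the identity. -/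
theorem norm_xiProj_le {n : ℕ} (v : R2 n) : ‖xiProj n v‖ ≤ ‖v‖ := by
  rw [EuclideanSpace.norm_eq, EuclideanSpace.norm_eq]
  refine Real.sqrt_le_sqrt (Finset.sum_le_sum fun k _ => ?_)
  rcases index_cases k with ⟨i, rfl⟩ | ⟨i, rfl⟩
  · rw [← xPart_apply, xPart_xiProj]
    simp [sq_nonneg]
  · rw [← xiPart_apply, xiPart_xiProj, xiPart_apply]

/-- The vector with `ξ_i = 1` and all other coordinates zero. -/
def xiVec {n : ℕ} (i : Fin n) : R2 n := combine n (0, Pi.single i 1)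

theorem xiProj_eq_sum {n : ℕ} (v : R2 n) : xiProj n v = ∑ i, xiPart n v i • xiVec i := by
  refine R2_ext ?_ ?_
  · simp [xiVec]
  · ext j
    simp only [xiPart_xiProj, map_sum, map_smul, xiVec, xiPart_combine, Finset.sum_apply,
      Pi.smul_apply, Pi.single_apply, smul_eq_mul, mul_ite, mul_one, mul_zero,
      Finset.sum_ite_eq, Finset.mem_univ, if_true]

/-! ### Darboux coordinates for the standard Lagrangian fibration -/

/-- A closed two-form on a ball for which the fibres `ξ = const` are isotropic has the form
`∑ i, dξ_i ∧ dX_i`. -/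
theorem exists_conjugate_coordinates {n : ℕ} {r : ℝ} (hr : 0 < r)
    {B : R2 n → R2 n →L[ℝ] R2 n →L[ℝ] ℝ} (hB : ContDiffOn ℝ ∞ B (Metric.ball 0 r))
    (halt : ∀ x ∈ Metric.ball 0 r, ∀ a b, B x a b = - B x b a)
    (hclosed : ∀ x ∈ Metric.ball 0 r, ∀ u v w,
      fderiv ℝ B x u v w = fderiv ℝ B x v u w - fderiv ℝ B x w u v)
    (hiso : ∀ x ∈ Metric.ball 0 r, ∀ a b, xiPart n a = 0 → xiPart n b = 0 → B x a b = 0) :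
    ∃ X : R2 n → Fin n → ℝ, ContDiffOn ℝ ∞ X (Metric.ball 0 r) ∧ X 0 = 0 ∧
      ∀ x ∈ Metric.ball 0 r, ∀ a b, B x a b =
        ∑ i, (xiPart n a i * fderiv ℝ X x b i - xiPart n b i * fderiv ℝ X x a i) := by
  set W : Set (R2 n) := Metric.ball 0 r with hWdef
  have hW : IsOpen W := Metric.isOpen_ball
  set Q := xiProj n with hQdef
  have hQW : ∀ x ∈ W, Q x ∈ W := fun x hx => by
    rw [hWdef, mem_ball_zero_iff] at hx ⊢
    exact (norm_xiProj_le x).trans_lt hx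
  have hconv : Convex ℝ W := convex_ball 0 r
  have hA : ∀ t ∈ Icc (0 : ℝ) 1, ∀ x ∈ W, Q x + t • (x - Q x) ∈ W := fun t ht x hx =>
    hconv.add_smul_sub_mem (hQW x hx) hx ht
  obtain ⟨θ₁, hθ₁, hvan, hd₁⟩ := exists_primitive_sub hW hB halt hclosed Q hA
  -- For the zero map the pulled-back form vanishes, which gives the ordinary Poincaré lemma.
  obtain ⟨θ₀, hθ₀, -, hd₀⟩ := exists_primitive_sub hW hB halt hclosed 0 fun t ht x hx => by
    have := hconv.add_smul_sub_mem (Metric.mem_ball_self hr) hx ht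
    simpa using this
  have hd₁' : ∀ x ∈ W, DifferentiableAt ℝ θ₁ x := fun x hx =>
    (hθ₁.differentiableOn (by simp)).differentiableAt (hW.mem_nhds hx)
  have hd₀' : ∀ x ∈ W, DifferentiableAt ℝ θ₀ x := fun x hx =>
    (hθ₀.differentiableOn (by simp)).differentiableAt (hW.mem_nhds hx)
  -- Both `x - Q x` and the image of a fibre vector under the homotopy are tangent to the fibre, so
  -- isotropy kills the integrand of `θ₁`.
  have hker : ∀ x ∈ W, ∀ a v, xiPart n v = 0 → fderiv ℝ θ₁ x a v = 0 := by
    intro x hx a v hv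
    have h1 := (hd₁' x hx).hasFDerivAt.clm_apply (hasFDerivAt_const v x)
    have h2 : (fun y => θ₁ y v) =ᶠ[nhds x] fun _ => 0 := by
      filter_upwards [hW.mem_nhds hx] with y hy
      refine hvan y v fun t ht => hiso _ (hA t ht y hy) _ _ ?_ ?_
      · simp [hQdef]
      · simp [hQdef, hv]
    have h3 := congrArg (fun l : R2 n →L[ℝ] ℝ => l a)
      (h1.unique ((hasFDerivAt_const (0 : ℝ) x).congr_of_eventuallyEq h2))
    simpa using h3
  have hQd : ∀ x ∈ W, ∀ a b, fderiv ℝ θ₁ x a b = fderiv ℝ θ₁ x a (Q b) := by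
    intro x hx a b
    have := hker x hx a (b - Q b) (by simp [hQdef])
    rwa [map_sub, sub_eq_zero] at this
  set ev : (R2 n →L[ℝ] ℝ) →L[ℝ] (Fin n → ℝ) :=
    ContinuousLinearMap.pi fun i => ContinuousLinearMap.apply ℝ ℝ (xiVec i) with hev
  -- Only the values on `xiVec i` matter: they are the coefficients of `dξ_i` in `θ₁ + Q^*θ₀`,
  -- because `Q` fixes these vectors.
  set β : R2 n → R2 n →L[ℝ] ℝ := fun x => θ₁ x + θ₀ (Q x) with hβ
  have hβs : ContDiffOn ℝ ∞ β W := hθ₁.add (hθ₀.comp Q.contDiff.contDiffOn hQW)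
  have hβd : ∀ x ∈ W, HasFDerivAt β (fderiv ℝ θ₁ x + (fderiv ℝ θ₀ (Q x)).comp Q) x := fun x hx =>
    (hd₁' x hx).hasFDerivAt.add
      (HasFDerivAt.comp (G := R2 n →L[ℝ] ℝ) x (hd₀' _ (hQW x hx)).hasFDerivAt Q.hasFDerivAt)
  -- The sign comes from `dβ_i ∧ dξ_i = dξ_i ∧ d(-β_i)`; the constant normalises `X` at the origin.
  refine ⟨fun x => ev (β 0) - ev (β x), contDiffOn_const.sub (ev.contDiff.comp_contDiffOn hβs),
    sub_self _, fun x hx a b => ?_⟩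
  have hXd : ∀ v i, fderiv ℝ (fun x => ev (β 0) - ev (β x)) x v i =
      -(fderiv ℝ θ₁ x v (xiVec i) + fderiv ℝ θ₀ (Q x) (Q v) (xiVec i)) := by
    intro v i
    have h1 : HasFDerivAt (fun x => ev (β x))
        (ev.comp (fderiv ℝ θ₁ x + (fderiv ℝ θ₀ (Q x)).comp Q)) x :=
      HasFDerivAt.comp (F := R2 n →L[ℝ] ℝ) x ev.hasFDerivAt (hβd x hx)
    rw [(h1.const_sub (ev (β 0))).fderiv]
    simp [hev]
  have hsum : ∀ v u, ∑ i, xiPart n u i * fderiv ℝ (fun x => ev (β 0) - ev (β x)) x v i =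
      -(fderiv ℝ θ₁ x v (Q u) + fderiv ℝ θ₀ (Q x) (Q v) (Q u)) := by
    intro v u
    simp only [hXd]
    rw [hQdef, xiProj_eq_sum u]
    simp only [map_sum, map_smul, smul_eq_mul, mul_neg, mul_add, Finset.sum_neg_distrib,
      Finset.sum_add_distrib]
  rw [Finset.sum_sub_distrib, hsum b a, hsum a b, ← hQd x hx, ← hQd x hx]
  have e1 := hd₁ x hx a b
  have e0 := hd₀ (Q x) (hQW x hx) (Q a) (Q b)
  simp only [zero_apply, map_zero, sub_zero] at e0
  linarith

/-! ### Isotropy of the fibres of a system in involution -/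

/-- If `n` independent covectors on a symplectic space of dimension `2n` are in involution, their
common kernel is isotropic. -/
theorem isotropic_ker_of_involution {n : ℕ} {V : Type*} [AddCommGroup V] [Module ℝ V]
    [TopologicalSpace V] [FiniteDimensional ℝ V] (hV : Module.finrank ℝ V = 2 * n)
    (B : V →ₗ[ℝ] V →ₗ[ℝ] ℝ) (halt : ∀ a b, B a b = - B b a)
    (L : V →ₗ[ℝ] Fin n → ℝ) (hL : Surjective L) (X : Fin n → V)
    (hX : ∀ i v, B (X i) v = -(L v i)) (hinv : ∀ i j, B (X i) (X j) = 0)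
    {a b : V} (ha : L a = 0) (hb : L b = 0) : B a b = 0 := by
  have hT : ∀ (c : Fin n → ℝ) v, B (Fintype.linearCombination ℝ X c) v = -∑ i, c i * L v i := by
    intro c v
    simp [Fintype.linearCombination_apply, hX]
  have hinj : Injective (Fintype.linearCombination ℝ X) := by
    rw [← LinearMap.ker_eq_bot, LinearMap.ker_eq_bot']
    intro c hc
    ext j
    obtain ⟨v, hv⟩ := hL (Pi.single j 1)
    have h := hT c v
    rw [hc, hv] at h
    simpa [Pi.single_apply] using h.symm
  have hle : LinearMap.range (Fintype.linearCombination ℝ X) ≤ LinearMap.ker L := by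
    rintro _ ⟨c, rfl⟩
    rw [LinearMap.mem_ker]
    ext j
    have h1 := hX j (Fintype.linearCombination ℝ X c)
    have h2 := hT c (X j)
    rw [halt, h2] at h1
    have h3 : ∀ i, L (X j) i = 0 := fun i => by
      have := hX i (X j)
      rw [hinv] at this
      linarith
    simp [h3] at h1
    simpa using h1
  have heq : LinearMap.range (Fintype.linearCombination ℝ X) = LinearMap.ker L := by
    refine Submodule.eq_of_le_of_finrank_eq hle ?_
    have h1 := LinearMap.finrank_range_of_inj hinj
    have h2 := L.finrank_range_add_finrank_ker
    rw [LinearMap.range_eq_top.2 hL, finrank_top] at h2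
    simp at h1 h2
    omega
  have ha' : a ∈ LinearMap.range (Fintype.linearCombination ℝ X) := heq ▸ ha
  obtain ⟨c, rfl⟩ := ha'
  rw [hT, hb]
  simp

/-! ### Local inverses -/

/-- The inverse function theorem for smooth maps, with smooth inverse on the whole target. -/
theorem exists_smooth_openPartialHomeomorph {E : Type*} [NormedAddCommGroup E] [NormedSpace ℝ E]
    [FiniteDimensional ℝ E] {W : Set E} (hW : IsOpen W) {g : E → E} (hg : ContDiffOn ℝ ∞ g W)
    {p : E} (hp : p ∈ W) (hinj : Injective (fderiv ℝ g p)) :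
    ∃ ψ : OpenPartialHomeomorph E E, ⇑ψ = g ∧ p ∈ ψ.source ∧ ψ.source ⊆ W ∧
      ContDiffOn ℝ ∞ ψ.symm ψ.target := by
  have : CompleteSpace E := FiniteDimensional.complete ℝ E
  have hd : ∀ y ∈ W, HasFDerivAt g (fderiv ℝ g y) y := fun y hy =>
    ((hg.differentiableOn (by simp)).differentiableAt (hW.mem_nhds hy)).hasFDerivAt
  set S : Set (E →L[ℝ] E) := range ((↑) : (E ≃L[ℝ] E) → E →L[ℝ] E)
  have hcont : ContinuousOn (fderiv ℝ g) W := hg.continuousOn_fderiv_of_isOpen hW (by simp)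
  -- Shrinking to the open set where the derivative is invertible makes the inverse smooth on its
  -- whole target, not just near `g p`.
  have hO : IsOpen (W ∩ fderiv ℝ g ⁻¹' S) :=
    hcont.isOpen_inter_preimage hW ContinuousLinearEquiv.isOpen
  obtain ⟨A, hA⟩ : fderiv ℝ g p ∈ S :=
    ⟨(LinearEquiv.ofInjectiveEndo (fderiv ℝ g p : E →ₗ[ℝ] E) hinj).toContinuousLinearEquiv, by
      ext v; rfl⟩
  have hgp : ContDiffAt ℝ ∞ g p := hg.contDiffAt (hW.mem_nhds hp)
  have hA' : HasFDerivAt g (A : E →L[ℝ] E) p := hA ▸ hd p hp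
  set ψ := hgp.toOpenPartialHomeomorph g hA' (by simp) with hψ
  refine ⟨ψ.restrOpen _ hO, rfl, ?_, ?_, ?_⟩
  · rw [OpenPartialHomeomorph.restrOpen_source]
    exact ⟨hgp.mem_toOpenPartialHomeomorph_source hA' (by simp), hp, A, hA⟩
  · rw [OpenPartialHomeomorph.restrOpen_source]
    exact fun y hy => hy.2.1
  · intro z hz
    have hy := (ψ.restrOpen _ hO).map_target hz
    rw [OpenPartialHomeomorph.restrOpen_source] at hy
    obtain ⟨-, hyW, C, hC⟩ := hy
    refine (OpenPartialHomeomorph.contDiffAt_symm _ hz (f₀' := C) ?_ ?_).contDiffWithinAt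
    · rw [hC]; exact hd _ hyW
    · exact hg.contDiffAt (hW.mem_nhds hyW)

theorem fderiv_symm_fderiv {E : Type*} [NormedAddCommGroup E] [NormedSpace ℝ E]
    (ψ : OpenPartialHomeomorph E E) (hψ : ContDiffOn ℝ ∞ ψ ψ.source)
    (hψ' : ContDiffOn ℝ ∞ ψ.symm ψ.target) {y : E} (hy : y ∈ ψ.source) (v : E) :
    fderiv ℝ ψ.symm (ψ y) (fderiv ℝ ψ y v) = v := by
  have h1 := ((hψ.differentiableOn (by simp)).differentiableAt
    (ψ.open_source.mem_nhds hy)).hasFDerivAt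
  have h2 := ((hψ'.differentiableOn (by simp)).differentiableAt
    (ψ.open_target.mem_nhds (ψ.map_source hy))).hasFDerivAt
  have h3 : (fun z => ψ.symm (ψ z)) =ᶠ[nhds y] id := by
    filter_upwards [ψ.open_source.mem_nhds hy] with z hz using ψ.left_inv hz
  have h4 := (h2.comp y h1).unique ((hasFDerivAt_id y).congr_of_eventuallyEq h3)
  simpa using congrArg (fun l : E →L[ℝ] E => l v) h4

/-! ### Darboux coordinates in Euclidean space -/

theorem compContinuousLinearMap_pair {V W : Type*} [AddCommGroup V] [Module ℝ V]
    [TopologicalSpace V] [AddCommGroup W] [Module ℝ W] [TopologicalSpace W]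
    (α : W [⋀^Fin 2]→L[ℝ] ℝ) (D : V →L[ℝ] W) (v w : V) :
    α.compContinuousLinearMap D ![v, w] = α ![D v, D w] := by
  rw [ContinuousAlternatingMap.compContinuousLinearMap_apply]
  congr 1
  ext i; fin_cases i <;> rfl

theorem curryForm_pullback {E : Type} [NormedAddCommGroup E] [NormedSpace ℝ E]
    (τ : E [⋀^Fin 2]→L[ℝ] ℝ) (D : E →L[ℝ] E) (a b : E) :
    curryForm E (τ.compContinuousLinearMap D) a b = τ ![D a, D b] := by
  rw [curryForm_apply, compContinuousLinearMap_pair]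

theorem contDiffOn_clm_comp {E G H : Type*} [NormedAddCommGroup E] [NormedSpace ℝ E]
    [NormedAddCommGroup G] [NormedSpace ℝ G] [NormedAddCommGroup H] [NormedSpace ℝ H]
    (L : G →L[ℝ] H) {T : Set E} {h : E → G} (hh : ContDiffOn ℝ ∞ h T) :
    ContDiffOn ℝ ∞ (fun z => L (h z)) T :=
  L.contDiff.comp_contDiffOn hh

theorem contDiffOn_curryForm_pullback {E : Type} [NormedAddCommGroup E] [NormedSpace ℝ E]
    {W T : Set E} (hT : IsOpen T) {τ : E → E [⋀^Fin 2]→L[ℝ] ℝ} (hτ : ContDiffOn ℝ ∞ τ W)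
    {h : E → E} (hh : ContDiffOn ℝ ∞ h T) (hTW : MapsTo h T W) :
    ContDiffOn ℝ ∞
      (fun z => curryForm E ((τ (h z)).compContinuousLinearMap (fderiv ℝ h z))) T := by
  have hD : ContDiffOn ℝ ∞ (fderiv ℝ h) T := hh.fderiv_of_isOpen hT (by simp)
  have h0 : ContDiffOn ℝ ∞ (fun z => τ (h z)) T := hτ.comp hh hTW
  have h1 : ContDiffOn ℝ ∞ (fun z => curryForm E (τ (h z))) T :=
    contDiffOn_clm_comp (G := E [⋀^Fin 2]→L[ℝ] ℝ) (H := E →L[ℝ] E →L[ℝ] ℝ) (curryForm E) h0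
  have h2 : ContDiffOn ℝ ∞ (fun z => (ContinuousLinearMap.compL ℝ E E ℝ).flip (fderiv ℝ h z)) T :=
    ContDiff.comp_contDiffOn (ContinuousLinearMap.contDiff _) hD
  refine (h2.clm_comp (h1.clm_comp hD)).congr fun z _ => ?_
  ext a b
  rw [curryForm_pullback]
  simp [curryForm_apply]

/-- The kernel of `L` has dimension `2n - n = n`. A linear projection onto it, followed by an
isomorphism with `ℝⁿ`, detects what `L` misses. -/
theorem exists_injective_prod_of_surjective {n : ℕ} (L : R2 n →ₗ[ℝ] Fin n → ℝ)
    (hL : Surjective L) :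
    ∃ C : R2 n →L[ℝ] (Fin n → ℝ), ∀ v, C v = 0 → L v = 0 → v = 0 := by
  have hk : Module.finrank ℝ (LinearMap.ker L) = Module.finrank ℝ (Fin n → ℝ) := by
    have h2 := L.finrank_range_add_finrank_ker
    rw [LinearMap.range_eq_top.2 hL, finrank_top] at h2
    simp at h2 ⊢
    omega
  let κ := LinearEquiv.ofFinrankEq _ _ hk
  obtain ⟨pr, hpr⟩ := (LinearMap.ker L).subtype.exists_leftInverse_of_injective
    (Submodule.ker_subtype _)
  refine ⟨LinearMap.toContinuousLinearMap (κ.toLinearMap ∘ₗ pr), fun v hC hv => ?_⟩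
  have h1 : pr v = 0 := κ.map_eq_zero_iff.1 hC
  have h2 : pr v = ⟨v, hv⟩ := congrArg (fun l : LinearMap.ker L →ₗ[ℝ] LinearMap.ker L =>
    l ⟨v, hv⟩) hpr
  simpa using congrArg Subtype.val (h2.symm.trans h1)

/-- The components of the linear map `L` are in involution for the two-form `τ`. -/
def InInvolutionAt {n : ℕ} (τ : R2 n [⋀^Fin 2]→L[ℝ] ℝ) (L : R2 n →L[ℝ] R1 n) : Prop :=
  ∀ (i j : Fin n) (X Y : R2 n), (∀ v, τ ![X, v] = -(L v i)) → (∀ v, τ ![Y, v] = -(L v j)) →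
    τ ![X, Y] = 0

theorem isotropic_of_inInvolutionAt {n : ℕ} {τ : R2 n [⋀^Fin 2]→L[ℝ] ℝ} {L : R2 n →L[ℝ] R1 n}
    (hinv : InInvolutionAt τ L) (hnd : ∀ v, (∀ w, τ ![v, w] = 0) → v = 0) (hL : Surjective L)
    {a b : R2 n} (ha : L a = 0) (hb : L b = 0) : τ ![a, b] = 0 := by
  choose X hX using fun i : Fin n => exists_contract_eq τ hnd
    (-((EuclideanSpace.proj (𝕜 := ℝ) i).comp L : R2 n →L[ℝ] ℝ) : R2 n →ₗ[ℝ] ℝ)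
  let B : R2 n →ₗ[ℝ] R2 n →ₗ[ℝ] ℝ :=
    LinearMap.mk₂ ℝ (fun v w => curryForm (R2 n) τ v w) (by simp) (by simp) (by simp) (by simp)
  have hBa : ∀ v w, B v w = τ ![v, w] := fun v w => curryForm_apply τ v w
  let e := (WithLp.linearEquiv 2 ℝ (Fin n → ℝ))
  have h := isotropic_ker_of_involution (n := n) (by simp) B
    (fun a b => by rw [hBa, hBa, form_swap]) (e.toLinearMap ∘ₗ (L : R2 n →ₗ[ℝ] R1 n))
    (e.surjective.comp hL) X (fun i v => by rw [hBa, hX]; rfl)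
    (fun i j => by rw [hBa]; exact hinv i j _ _ (fun v => hX i v) (fun v => hX j v))
    (a := a) (b := b) (by simp [ha]) (by simp [hb])
  rwa [hBa] at h

/-- The theorem of Darboux and Carathéodory on an open subset of `ℝ²ⁿ`. -/
theorem exists_darboux_coordinates {n : ℕ} {W : Set (R2 n)} (hW : IsOpen W)
    {τ : R2 n → R2 n [⋀^Fin 2]→L[ℝ] ℝ} (hτ : ContDiffOn ℝ ∞ τ W)
    (hclosed : ∀ y ∈ W, extDeriv τ y = 0)
    (hnd : ∀ y ∈ W, ∀ v, (∀ w, τ y ![v, w] = 0) → v = 0)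
    {f : R2 n → R1 n} (hf : ContDiffOn ℝ ∞ f W)
    (hinv : ∀ y ∈ W, InInvolutionAt (τ y) (fderiv ℝ f y))
    {p : R2 n} (hp : p ∈ W) (hsurj : Surjective (fderiv ℝ f p)) :
    ∃ ψ : OpenPartialHomeomorph (R2 n) (R2 n), p ∈ ψ.source ∧ ψ.source ⊆ W ∧
      ContDiffOn ℝ ∞ ψ ψ.source ∧ ContDiffOn ℝ ∞ ψ.symm ψ.target ∧ ψ p = 0 ∧
      (∀ y ∈ ψ.source, ∀ i, xiPart n (ψ y) i = f y i - f p i) ∧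
      ∀ y ∈ ψ.source, ∀ a b, τ y ![a, b] =
        ∑ i, (xiPart n (fderiv ℝ ψ y a) i * xPart n (fderiv ℝ ψ y b) i -
          xiPart n (fderiv ℝ ψ y b) i * xPart n (fderiv ℝ ψ y a) i) := by
  have hfd : ∀ y ∈ W, HasFDerivAt f (fderiv ℝ f y) y := fun y hy =>
    ((hf.differentiableOn (by simp)).differentiableAt (hW.mem_nhds hy)).hasFDerivAt
  let e : R1 n ≃L[ℝ] (Fin n → ℝ) := EuclideanSpace.equiv (Fin n) ℝ
  obtain ⟨C, hC⟩ := exists_injective_prod_of_surjective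
    ((e : R1 n →L[ℝ] (Fin n → ℝ)).comp (fderiv ℝ f p)).toLinearMap (e.surjective.comp hsurj)
  -- The complementary coordinates `C` are arbitrary here; they are replaced by conjugate ones in
  -- `k` below.
  set g : R2 n → R2 n := fun y => combine n (C (y - p), e (f y - f p)) with hg
  have hgs : ContDiffOn ℝ ∞ g W := by
    refine (combine n).contDiff.comp_contDiffOn (ContDiffOn.prodMk ?_ ?_)
    · exact (C.contDiff.comp (contDiff_id.sub contDiff_const)).contDiffOn
    · exact e.contDiff.comp_contDiffOn (hf.sub contDiffOn_const)
  have hgd : HasFDerivAt g ((combine n).comp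
      (C.prod ((e : R1 n →L[ℝ] (Fin n → ℝ)).comp (fderiv ℝ f p)))) p := by
    refine (combine n).hasFDerivAt.comp p (HasFDerivAt.prodMk ?_ ?_)
    · exact C.hasFDerivAt.comp p ((hasFDerivAt_id p).sub_const p)
    · exact e.hasFDerivAt.comp p ((hfd p hp).sub_const (f p))
  have hginj : Injective (fderiv ℝ g p) := by
    rw [hgd.fderiv, injective_iff_map_eq_zero]
    intro v hv
    have hx := congrArg (xPart n) hv
    have hξ := congrArg (xiPart n) hv
    simp only [ContinuousLinearMap.comp_apply, xPart_combine, xiPart_combine, map_zero] at hx hξ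
    exact hC v hx hξ
  obtain ⟨ψ₁, hψ₁, hp₁, hs₁, hsymm₁⟩ := exists_smooth_openPartialHomeomorph hW hgs hp hginj
  have hψ₁s : ContDiffOn ℝ ∞ ψ₁ ψ₁.source := by rw [hψ₁]; exact hgs.mono hs₁
  have hψ₁p : ψ₁ p = 0 := by simp [hψ₁, hg, combine_zero]
  have hT : IsOpen ψ₁.target := ψ₁.open_target
  have hTW : MapsTo ψ₁.symm ψ₁.target W := fun z hz => hs₁ (ψ₁.map_target hz)
  have h0T : (0 : R2 n) ∈ ψ₁.target := hψ₁p ▸ ψ₁.map_source hp₁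
  obtain ⟨r, hr, hrT⟩ := Metric.isOpen_iff.1 hT 0 h0T
  have hfψ : ∀ z ∈ ψ₁.target, f (ψ₁.symm z) = e.symm (xiPart n z) + f p := by
    intro z hz
    have h := congrArg (xiPart n) (ψ₁.right_inv hz)
    rw [hψ₁] at h
    simp only [hg, xiPart_combine] at h
    rw [← h]
    simp
  have hsd : ∀ z ∈ ψ₁.target, HasFDerivAt ψ₁.symm (fderiv ℝ ψ₁.symm z) z := fun z hz =>
    ((hsymm₁.differentiableOn (by simp)).differentiableAt (hT.mem_nhds hz)).hasFDerivAt
  have hfD : ∀ z ∈ ψ₁.target, ∀ v,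
      fderiv ℝ f (ψ₁.symm z) (fderiv ℝ ψ₁.symm z v) = e.symm (xiPart n v) := by
    intro z hz v
    have h1 := (hfd _ (hTW hz)).comp z (hsd z hz)
    have h2 : HasFDerivAt (fun z => e.symm (xiPart n z) + f p)
        ((e.symm : (Fin n → ℝ) →L[ℝ] R1 n).comp (xiPart n)) z :=
      (e.symm.hasFDerivAt.comp z (xiPart n).hasFDerivAt).add_const _
    have h3 : (f ∘ ψ₁.symm) =ᶠ[nhds z] fun z => e.symm (xiPart n z) + f p := by
      filter_upwards [hT.mem_nhds hz] with w hw using hfψ w hw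
    exact congrArg (fun l : R2 n →L[ℝ] R1 n => l v) (h1.unique (h2.congr_of_eventuallyEq h3))
  set τ' : R2 n → R2 n [⋀^Fin 2]→L[ℝ] ℝ :=
    fun z => (τ (ψ₁.symm z)).compContinuousLinearMap (fderiv ℝ ψ₁.symm z) with hτ'
  have hBs := (contDiffOn_curryForm_pullback hT hτ hsymm₁ hTW).mono hrT
  have hτd : ∀ y ∈ W, DifferentiableAt ℝ τ y := fun y hy =>
    (hτ.differentiableOn (by simp)).differentiableAt (hW.mem_nhds hy)
  have hBclosed : ∀ z ∈ ψ₁.target, ∀ u v w,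
      fderiv ℝ (fun z => curryForm (R2 n) (τ' z)) z u v w =
        fderiv ℝ (fun z => curryForm (R2 n) (τ' z)) z v u w -
        fderiv ℝ (fun z => curryForm (R2 n) (τ' z)) z w u v := by
    intro z hz
    refine fderiv_curryForm_cyclic ?_ ?_
    · refine DifferentiableAt.continuousAlternatingMapCompContinuousLinearMap ?_ ?_
      · exact (hτd _ (hTW hz)).comp z (hsd z hz).differentiableAt
      · exact ((hsymm₁.fderiv_of_isOpen hT (m := ∞) (by simp)).differentiableOn
          (by simp)).differentiableAt (hT.mem_nhds hz)
    · have := extDeriv_pullback (r := ∞) (hτd _ (hTW hz)) (hsymm₁.contDiffAt (hT.mem_nhds hz))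
        (by simpa using WithTop.coe_le_coe.2 (le_top : (2 : ℕ∞) ≤ ⊤))
      rw [hτ', this, hclosed _ (hTW hz)]
      ext v
      simp
  obtain ⟨X, hXs, hX0, hX⟩ := exists_conjugate_coordinates hr hBs
    (fun z _ a b => by rw [curryForm_apply, curryForm_apply, form_swap])
    (fun z hz => hBclosed z (hrT hz))
    (fun z hz a b ha hb => by
      rw [curryForm_pullback]
      refine isotropic_of_inInvolutionAt (hinv _ (hTW (hrT hz))) (hnd _ (hTW (hrT hz))) ?_ ?_ ?_
      -- In the new coordinates `f` is `ξ` up to a constant, so every point of the ball is regular.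
      · intro c
        exact ⟨fderiv ℝ ψ₁.symm z (combine n (0, e c)), by simp [hfD z (hrT hz)]⟩
      · rw [hfD z (hrT hz), ha, map_zero]
      · rw [hfD z (hrT hz), hb, map_zero])
  set W₂ : Set (R2 n) := Metric.ball 0 r
  have hW₂ : IsOpen W₂ := Metric.isOpen_ball
  have h0 : (0 : R2 n) ∈ W₂ := Metric.mem_ball_self hr
  set k : R2 n → R2 n := fun z => combine n (X z, xiPart n z) with hk
  have hks : ContDiffOn ℝ ∞ k W₂ :=
    (combine n).contDiff.comp_contDiffOn (hXs.prodMk (xiPart n).contDiff.contDiffOn)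
  have hkd : ∀ z ∈ W₂, HasFDerivAt k ((combine n).comp ((fderiv ℝ X z).prod (xiPart n))) z :=
    fun z hz => (combine n).hasFDerivAt.comp z
      (((hXs.differentiableOn (by simp)).differentiableAt (hW₂.mem_nhds hz)).hasFDerivAt.prodMk
        (xiPart n).hasFDerivAt)
  have hkinj : Injective (fderiv ℝ k 0) := by
    rw [(hkd 0 h0).fderiv, injective_iff_map_eq_zero]
    intro v hv
    have hx := congrArg (xPart n) hv
    have hξ := congrArg (xiPart n) hv
    simp only [ContinuousLinearMap.comp_apply, ContinuousLinearMap.prod_apply, xPart_combine,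
      xiPart_combine, map_zero] at hx hξ
    -- If `dX` and `dξ` both kill `v`, then so does contraction with `∑ dξ_i ∧ dX_i`, and
    -- non-degeneracy applies.
    have hz : fderiv ℝ ψ₁.symm 0 v = 0 := by
      refine hnd _ (hTW h0T) _ fun w => ?_
      have h1 := hX 0 h0 v (fderiv ℝ ψ₁ p w)
      rw [curryForm_pullback, hx, hξ, ← hψ₁p,
        fderiv_symm_fderiv ψ₁ hψ₁s hsymm₁ hp₁] at h1
      rw [← hψ₁p, h1]
      simp
    have h2 := fderiv_symm_fderiv ψ₁.symm hsymm₁ hψ₁s h0T v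
    rw [hz, map_zero] at h2
    exact h2.symm
  obtain ⟨ψ₂, hψ₂, hp₂, hs₂, hsymm₂⟩ := exists_smooth_openPartialHomeomorph hW₂ hks h0 hkinj
  have hψ₂s : ContDiffOn ℝ ∞ ψ₂ ψ₂.source := by rw [hψ₂]; exact hks.mono hs₂
  have hsrc : ∀ y ∈ (ψ₁.trans ψ₂).source, y ∈ ψ₁.source ∧ ψ₁ y ∈ ψ₂.source := fun y hy => by
    simpa using hy
  refine ⟨ψ₁.trans ψ₂, ?_, fun y hy => hs₁ (hsrc y hy).1, ?_, ?_, ?_, ?_, ?_⟩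
  · rw [OpenPartialHomeomorph.trans_source]
    exact ⟨hp₁, by rw [mem_preimage, hψ₁p]; exact hp₂⟩
  · exact hψ₂s.comp (hψ₁s.mono fun y hy => (hsrc y hy).1) fun y hy => (hsrc y hy).2
  · rw [OpenPartialHomeomorph.trans_target]
    exact hsymm₁.comp (hsymm₂.mono fun z hz => hz.1) fun z hz => hz.2
  · simp [hψ₁p, hψ₂, hk, hX0, combine_zero]
  · intro y hy i
    simp [hψ₂, hk, -xiPart_apply]
    simp [hψ₁, hg, -xiPart_apply, e]
  · intro y hy a b
    obtain ⟨hy₁, hy₂⟩ := hsrc y hy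
    have hd₁ := ((hψ₁s.differentiableOn (by simp)).differentiableAt
      (ψ₁.open_source.mem_nhds hy₁)).hasFDerivAt
    have hd₂ := hkd _ (hs₂ hy₂)
    have hd : fderiv ℝ (ψ₁.trans ψ₂) y =
        ((combine n).comp ((fderiv ℝ X (ψ₁ y)).prod (xiPart n))).comp (fderiv ℝ ψ₁ y) := by
      rw [OpenPartialHomeomorph.coe_trans, hψ₂]
      exact (hd₂.comp y hd₁).fderiv
    have h1 := hX _ (hs₂ hy₂) (fderiv ℝ ψ₁ y a) (fderiv ℝ ψ₁ y b)
    rw [curryForm_pullback, ψ₁.left_inv hy₁, fderiv_symm_fderiv ψ₁ hψ₁s hsymm₁ hy₁,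
      fderiv_symm_fderiv ψ₁ hψ₁s hsymm₁ hy₁] at h1
    rw [h1, hd]
    simp only [ContinuousLinearMap.comp_apply, ContinuousLinearMap.prod_apply, xPart_combine,
      xiPart_combine]

/-! ### Passing to charts -/

section Charts

variable {n : ℕ} {M : Type*} [TopologicalSpace M] [ChartedSpace (R2 n) M]

theorem form_ext {V : Type*} [AddCommGroup V] [Module ℝ V] [TopologicalSpace V]
    {α β : V [⋀^Fin 2]→L[ℝ] ℝ} (h : ∀ v w, α ![v, w] = β ![v, w]) : α = β := by
  ext v
  have e : v = ![v 0, v 1] := by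
    ext i; fin_cases i <;> rfl
  rw [e]
  exact h _ _

theorem sum_wedge_apply {ι V : Type*} [Fintype ι] [AddCommGroup V] [Module ℝ V]
    [TopologicalSpace V] (α β : ι → V →L[ℝ] ℝ) (v w : V) :
    (∑ i, wedge (α i) (β i)) ![v, w] = ∑ i, (α i v * β i w - α i w * β i v) := by
  rw [ContinuousAlternatingMap.sum_apply]
  exact Finset.sum_congr rfl fun i _ => wedge_apply _ _ _ _

theorem inChart_apply (σ : TwoForm n M) (e : OpenPartialHomeomorph M (R2 n)) (y v w : R2 n) :
    inChart σ e y ![v, w] = σ (e.symm y) ![mfderiv (𝓡 (2 * n)) (𝓡 (2 * n)) e.symm y v,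
      mfderiv (𝓡 (2 * n)) (𝓡 (2 * n)) e.symm y w] :=
  compContinuousLinearMap_pair _ _ _ _

theorem mdifferentiableAt_symm {e : OpenPartialHomeomorph M (R2 n)}
    (he : e ∈ IsManifold.maximalAtlas (𝓡 (2 * n)) ∞ M) {y : R2 n} (hy : y ∈ e.target) :
    MDifferentiableAt (𝓡 (2 * n)) (𝓡 (2 * n)) e.symm y :=
  (contMDiffAt_symm_of_mem_maximalAtlas he hy).mdifferentiableAt (by simp)

theorem mdifferentiableAt_coe {e : OpenPartialHomeomorph M (R2 n)}
    (he : e ∈ IsManifold.maximalAtlas (𝓡 (2 * n)) ∞ M) {p : M} (hp : p ∈ e.source) :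
    MDifferentiableAt (𝓡 (2 * n)) (𝓡 (2 * n)) e p :=
  (contMDiffAt_of_mem_maximalAtlas he hp).mdifferentiableAt (by simp)

/-- The differential of a component of `h`. -/
theorem differential_component {ι : Type*} [Fintype ι] {h : M → EuclideanSpace ℝ ι} {p : M}
    (hh : MDifferentiableAt (𝓡 (2 * n)) 𝓘(ℝ, EuclideanSpace ℝ ι) h p) (k : ι)
    (v : TangentSpace (𝓡 (2 * n)) p) :
    differential (n := n) (fun q => h q k) p v =
      WithLp.ofLp (p := 2) (V := ι → ℝ)
        (mfderiv (𝓡 (2 * n)) 𝓘(ℝ, EuclideanSpace ℝ ι) h p v) k := by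
  let l : EuclideanSpace ℝ ι →L[ℝ] ℝ := EuclideanSpace.proj k
  have h1 := mfderiv_comp p (g := l) (l.differentiableAt.mdifferentiableAt) hh
  rw [mfderiv_eq_fderiv, l.fderiv] at h1
  exact congrArg (fun k : TangentSpace (𝓡 (2 * n)) p →L[ℝ] ℝ => k v) h1

theorem bijective_mfderiv_symm {e : OpenPartialHomeomorph M (R2 n)}
    (he : e ∈ IsManifold.maximalAtlas (𝓡 (2 * n)) ∞ M) {y : R2 n} (hy : y ∈ e.target) :
    Bijective (mfderiv (𝓡 (2 * n)) (𝓡 (2 * n)) e.symm y) := by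
  have hm : e.MDifferentiable (𝓡 (2 * n)) (𝓡 (2 * n)) :=
    ⟨fun p hp => (mdifferentiableAt_coe he hp).mdifferentiableWithinAt,
      fun z hz => (mdifferentiableAt_symm he hz).mdifferentiableWithinAt⟩
  exact hm.symm.mfderiv_bijective hy

theorem mfderiv_apply_mfderiv_symm {E' : Type*} [NormedAddCommGroup E'] [NormedSpace ℝ E']
    {e : OpenPartialHomeomorph M (R2 n)}
    (he : e ∈ IsManifold.maximalAtlas (𝓡 (2 * n)) ∞ M) {y : R2 n} (hy : y ∈ e.target)
    {h : M → E'} (hh : MDifferentiableAt (𝓡 (2 * n)) 𝓘(ℝ, E') h (e.symm y)) (v : R2 n) :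
    mfderiv (𝓡 (2 * n)) 𝓘(ℝ, E') h (e.symm y) (mfderiv (𝓡 (2 * n)) (𝓡 (2 * n)) e.symm y v) =
      fderiv ℝ (h ∘ e.symm) y v := by
  have h1 := mfderiv_comp y hh (mdifferentiableAt_symm he hy)
  rw [mfderiv_eq_fderiv] at h1
  rw [h1]
  rfl

theorem inInvolutionAt_inChart {σ : TwoForm n M} {F : M → R1 n} (hF : IsIntegrableSystem σ F)
    {e : OpenPartialHomeomorph M (R2 n)}
    (he : e ∈ IsManifold.maximalAtlas (𝓡 (2 * n)) ∞ M) {y : R2 n} (hy : y ∈ e.target) :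
    InInvolutionAt (inChart σ e y) (fderiv ℝ (F ∘ e.symm) y) := by
  set D := mfderiv (𝓡 (2 * n)) (𝓡 (2 * n)) e.symm y with hD
  have hFd : MDifferentiableAt (𝓡 (2 * n)) (𝓡 n) F (e.symm y) :=
    hF.smooth.mdifferentiableAt (by simp)
  -- By non-degeneracy the Hamiltonian equation has at most one solution, so a solution in the chart
  -- is carried to the Hamiltonian vector field on `M`.
  have key : ∀ (i : Fin n) (X : R2 n),
      (∀ v, inChart σ e y ![X, v] = -(fderiv ℝ (F ∘ e.symm) y v i)) →
      D X = hamiltonianVectorField σ (fun q => F q i) (e.symm y) := by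
    intro i X hX
    refine sub_eq_zero.1 (hF.symplectic.nondegenerate _ _ fun w => ?_)
    obtain ⟨v, rfl⟩ := (bijective_mfderiv_symm he hy).2 w
    have h1 : σ (e.symm y) ![D X, D v] =
        -WithLp.ofLp (p := 2) (V := Fin n → ℝ)
          (mfderiv (𝓡 (2 * n)) (𝓡 n) F (e.symm y) (D v)) i :=
      (inChart_apply σ e y X v).symm.trans ((hX v).trans
        (congrArg (fun c : R1 n => -c i) (mfderiv_apply_mfderiv_symm he hy hFd v).symm))
    have h2 := (hamiltonianVectorField_spec hF.symplectic (fun q => F q i) (e.symm y) (D v)).trans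
      (congrArg Neg.neg (differential_component hFd i (D v)))
    have h3 := (σ (e.symm y)).map_update_sub ![D X, D v] 0 (D X)
      (hamiltonianVectorField σ (fun q => F q i) (e.symm y))
    have e0 : ∀ x, Function.update ![D X, D v] 0 x = ![x, D v] := fun x => by
      ext j; fin_cases j <;> simp
    rw [e0, e0, e0] at h3
    exact h3.trans (sub_eq_zero.2 (h1.trans h2.symm))
  intro i j X Y hX hY
  refine (inChart_apply σ e y X Y).trans ?_
  rw [← hD, key i X hX, key j Y hY]
  exact hF.involution i j _

/-- The theorem of Darboux and Carathéodory in the form of a chart whose last `n` components are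
the functions `F_i - F_i(m)`. -/
theorem exists_darboux_chart [IsManifold (𝓡 (2 * n)) ∞ M] {σ : TwoForm n M} {F : M → R1 n}
    (hF : IsIntegrableSystem σ F) {m : M} (hm : IsRegularPoint F m) :
    ∃ e ∈ IsManifold.maximalAtlas (𝓡 (2 * n)) ∞ M, m ∈ e.source ∧ e m = 0 ∧
      (∀ p ∈ e.source, ∀ i, e p (xiIndex i) = F p i - F m i) ∧
      ∀ p ∈ e.source, σ p = ∑ i : Fin n,
        wedge (differential (n := n) (fun q => e q (xiIndex i)) p)
          (differential (n := n) (fun q => e q (xIndex i)) p) := by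
  set e₀ := chartAt (R2 n) m with he₀
  -- Smoothness and closedness of `σ` are assumed only in charts of the atlas, not of the maximal
  -- atlas.
  have hat : e₀ ∈ atlas (R2 n) M := chart_mem_atlas _ m
  have hmax : e₀ ∈ IsManifold.maximalAtlas (𝓡 (2 * n)) ∞ M :=
    IsManifold.chart_mem_maximalAtlas m
  have hm₀ : m ∈ e₀.source := mem_chart_source _ m
  have hFd : ∀ p, MDifferentiableAt (𝓡 (2 * n)) (𝓡 n) F p := fun p =>
    hF.smooth.mdifferentiableAt (by simp)
  have hsymm : ContMDiffOn (𝓡 (2 * n)) (𝓡 (2 * n)) ∞ e₀.symm e₀.target :=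
    contMDiffOn_symm_of_mem_maximalAtlas hmax
  have hfs : ContDiffOn ℝ ∞ (F ∘ e₀.symm) e₀.target :=
    (hF.smooth.comp_contMDiffOn hsymm).contDiffOn
  obtain ⟨ψ, hp, hs, hψ, hψ', hψp, hξ, hτ⟩ := exists_darboux_coordinates e₀.open_target
    (hF.symplectic.smooth e₀ hat) (hF.symplectic.closed e₀ hat)
    (fun y hy v hv => by
      have hb := bijective_mfderiv_symm hmax hy
      refine hb.1 ((hF.symplectic.nondegenerate _ _ fun w => ?_).trans (map_zero _).symm)
      obtain ⟨w, rfl⟩ := hb.2 w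
      exact (inChart_apply σ e₀ y v w).symm.trans (hv w))
    hfs (fun y hy => inInvolutionAt_inChart hF hmax hy) (e₀.map_source hm₀)
    (by
      intro c
      have hm' : IsRegularPoint F (e₀.symm (e₀ m)) := by rwa [e₀.left_inv hm₀]
      obtain ⟨w, hw⟩ := hm' c
      obtain ⟨v, rfl⟩ := (bijective_mfderiv_symm hmax (e₀.map_source hm₀)).2 w
      exact ⟨v, (mfderiv_apply_mfderiv_symm hmax (e₀.map_source hm₀) (hFd _) v).symm.trans hw⟩)
  have hsrc : ∀ p ∈ (e₀.trans ψ).source, p ∈ e₀.source ∧ e₀ p ∈ ψ.source := fun p hp => by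
    simpa using hp
  have hmem : e₀.trans ψ ∈ IsManifold.maximalAtlas (𝓡 (2 * n)) ∞ M := by
    refine OpenPartialHomeomorph.mem_maximalAtlas_of_contMDiffOn _ ?_ ?_
    · exact hψ.contMDiffOn.comp ((contMDiffOn_of_mem_maximalAtlas hmax).mono
        fun p hp => (hsrc p hp).1) fun p hp => (hsrc p hp).2
    · rw [OpenPartialHomeomorph.trans_target]
      exact hsymm.comp (hψ'.contMDiffOn.mono fun z hz => hz.1) fun z hz => hz.2
  refine ⟨e₀.trans ψ, hmem, ?_, by simpa using hψp, ?_, ?_⟩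
  · rw [OpenPartialHomeomorph.trans_source]
    exact ⟨hm₀, hp⟩
  · intro p hp i
    have := hξ _ (hsrc p hp).2 i
    simpa [e₀.left_inv (hsrc p hp).1, e₀.left_inv hm₀] using this
  · intro p hp
    obtain ⟨hp₀, hpψ⟩ := hsrc p hp
    obtain ⟨y, hy, rfl⟩ : ∃ y ∈ e₀.target, e₀.symm y = p :=
      ⟨e₀ p, e₀.map_source hp₀, e₀.left_inv hp₀⟩
    rw [e₀.right_inv hy] at hpψ
    have hed := mdifferentiableAt_coe hmem hp
    have hcoord : ∀ (k : Fin (2 * n)) (v : R2 n),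
        differential (n := n) (fun q => (e₀.trans ψ) q k) (e₀.symm y)
          (mfderiv (𝓡 (2 * n)) (𝓡 (2 * n)) e₀.symm y v) = fderiv ℝ ψ y v k := by
      intro k v
      refine (differential_component hed k _).trans ?_
      have : (e₀.trans ψ) ∘ e₀.symm =ᶠ[nhds y] ψ := by
        filter_upwards [e₀.open_target.mem_nhds hy] with z hz
        simp [e₀.right_inv hz]
      refine congrArg (fun c : R2 n => c k) ((mfderiv_apply_mfderiv_symm hmax hy hed v).trans ?_)
      rw [this.fderiv_eq]
    refine form_ext fun v w => ?_
    obtain ⟨a, rfl⟩ := (bijective_mfderiv_symm hmax hy).2 v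
    obtain ⟨b, rfl⟩ := (bijective_mfderiv_symm hmax hy).2 w
    refine (inChart_apply σ e₀ y a b).symm.trans ((hτ y hpψ a b).trans ?_)
    refine Eq.trans (Finset.sum_congr rfl fun i _ => ?_) (sum_wedge_apply _ _ _ _).symm
    exact congrArg₂ (· - ·)
      (congrArg₂ (· * ·) (hcoord (xiIndex i) a).symm (hcoord (xIndex i) b).symm)
      (congrArg₂ (· * ·) (hcoord (xiIndex i) b).symm (hcoord (xIndex i) a).symm)

/-! ### Symplectic equivalence with the standard system -/

/-- A chart, as a diffeomorphism from its source to its target. -/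
def chartDiffeomorph (e : OpenPartialHomeomorph M (R2 n))
    (he : e ∈ IsManifold.maximalAtlas (𝓡 (2 * n)) ∞ M) :
    (⟨e.source, e.open_source⟩ : Opens M) ≃ₘ^∞⟮𝓡 (2 * n), 𝓡 (2 * n)⟯
      (⟨e.target, e.open_target⟩ : Opens (R2 n)) where
  toFun p := ⟨e p, e.map_source p.2⟩
  invFun y := ⟨e.symm y, e.map_target y.2⟩
  left_inv p := Subtype.ext (e.left_inv p.2)
  right_inv y := Subtype.ext (e.right_inv y.2)
  contMDiff_toFun := (ContMDiff.subtypeVal_comp_iff _ _).1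
    ((contMDiffOn_of_mem_maximalAtlas he).comp_contMDiff contMDiff_subtype_val fun p => p.2)
  contMDiff_invFun := (ContMDiff.subtypeVal_comp_iff _ _).1
    ((contMDiffOn_symm_of_mem_maximalAtlas he).comp_contMDiff contMDiff_subtype_val fun p => p.2)

theorem canonicalForm_apply (q v w : R2 n) :
    canonicalForm n q ![v, w] =
      ∑ i : Fin n, (v (xiIndex i) * w (xIndex i) - w (xiIndex i) * v (xIndex i)) := by
  have h : ∀ (k : Fin (2 * n)) (u : R2 n),
      differential (n := n) (fun q : R2 n => q k) q u = u k := fun k u => by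
    rw [differential, mfderiv_eq_fderiv]
    exact congrArg (fun l : R2 n →L[ℝ] ℝ => l u) (EuclideanSpace.proj (𝕜 := ℝ) k).fderiv
  refine (sum_wedge_apply _ _ v w).trans (Finset.sum_congr rfl fun i _ => ?_)
  exact congrArg₂ (· - ·) (congrArg₂ (· * ·) (h _ v) (h _ w)) (congrArg₂ (· * ·) (h _ w) (h _ v))

/-- Including the target after the diffeomorphism is the same as applying `e` after including the
source; the chain rule on both sides reduces the claim to the coordinate formula for `σ`. -/
theorem pullback_chartDiffeomorph {σ : TwoForm n M} (e : OpenPartialHomeomorph M (R2 n))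
    (he : e ∈ IsManifold.maximalAtlas (𝓡 (2 * n)) ∞ M)
    (hσ : ∀ p ∈ e.source, σ p = ∑ i : Fin n,
      wedge (differential (n := n) (fun q => e q (xiIndex i)) p)
        (differential (n := n) (fun q => e q (xIndex i)) p)) :
    pullback (n := n) (chartDiffeomorph e he)
      (restrictForm (canonicalForm n) ⟨e.target, e.open_target⟩) =
    restrictForm σ ⟨e.source, e.open_source⟩ := by
  funext p
  have hed := mdifferentiableAt_coe he p.2
  set φ := chartDiffeomorph e he with hφ
  have hval : ∀ q : (⟨e.target, e.open_target⟩ : Opens (R2 n)),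
      MDifferentiableAt (𝓡 (2 * n)) (𝓡 (2 * n)) (Subtype.val : _ → R2 n) q := fun q =>
    contMDiff_subtype_val.mdifferentiableAt one_ne_zero
  have hval' : MDifferentiableAt (𝓡 (2 * n)) (𝓡 (2 * n))
      (Subtype.val : (⟨e.source, e.open_source⟩ : Opens M) → M) p :=
    contMDiff_subtype_val.mdifferentiableAt one_ne_zero
  have hφd : MDifferentiableAt (𝓡 (2 * n)) (𝓡 (2 * n)) φ p :=
    φ.contMDiff.mdifferentiableAt (by simp)
  have h1 := mfderiv_comp p (hval (φ p)) hφd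
  have h2 := mfderiv_comp p hed hval'
  have h3 : ∀ v, mfderiv (𝓡 (2 * n)) (𝓡 (2 * n)) (Subtype.val : _ → R2 n) (φ p)
      (mfderiv (𝓡 (2 * n)) (𝓡 (2 * n)) φ p v) =
      mfderiv (𝓡 (2 * n)) (𝓡 (2 * n)) e p
        (mfderiv (𝓡 (2 * n)) (𝓡 (2 * n)) Subtype.val p v) := fun v =>
    congrArg (fun l : TangentSpace (𝓡 (2 * n)) p →L[ℝ] R2 n => l v) (h1.symm.trans h2)
  refine form_ext fun v w => ?_
  refine (compContinuousLinearMap_pair _ _ _ _).trans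
    ((compContinuousLinearMap_pair _ _ _ _).trans ?_)
  refine Eq.trans ?_ (compContinuousLinearMap_pair _ _ _ _).symm
  rw [hσ _ p.2, sum_wedge_apply, h3, h3]
  refine (canonicalForm_apply _ _ _).trans (Finset.sum_congr rfl fun i _ => ?_)
  have hc := fun k u => (differential_component hed k u).symm
  exact congrArg₂ (· - ·) (congrArg₂ (· * ·) (hc _ _) (hc _ _))
    (congrArg₂ (· * ·) (hc _ _) (hc _ _))

end Charts

theorem isSmoothOnSubset_coe {n : ℕ} {A : Set (R1 n)} {h : A → R1 n}
    (hh : ∀ a : A, h a = a) : IsSmoothOnSubset h := fun _ =>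
  ⟨univ, id, isOpen_univ, mem_univ _, contDiffOn_id, fun b _ => (hh b).symm⟩

end DarbouxCaratheodory

end

/-! ### Both formulations from a single chart -/

theorem mainTheorem11 (n : ℕ) (M : Type*) [TopologicalSpace M]
    [ChartedSpace (DarbouxCaratheodory.R2 n) M] [IsManifold (𝓡 (2 * n)) ∞ M]
    (σ : DarbouxCaratheodory.TwoForm n M) (F : M → DarbouxCaratheodory.R1 n)
    (hF : DarbouxCaratheodory.IsIntegrableSystem σ F)
    (m : M) (hm : DarbouxCaratheodory.IsRegularPoint F m) :
    (∃ (U : Opens M) (V : Opens (DarbouxCaratheodory.R2 n))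
        (hmU : m ∈ U) (h0V : (0 : DarbouxCaratheodory.R2 n) ∈ V)
        (φ : U ≃ₘ^∞⟮𝓡 (2 * n), 𝓡 (2 * n)⟯ V)
        (hrange : range (DarbouxCaratheodory.restrictMap (fun p => F p - F m) U) =
          range (DarbouxCaratheodory.restrictMap (DarbouxCaratheodory.xiMap n) V)),
      φ ⟨m, hmU⟩ = ⟨0, h0V⟩ ∧
      DarbouxCaratheodory.IsStrongSymplecticEquivalence
        (DarbouxCaratheodory.restrictForm σ U)
        (DarbouxCaratheodory.restrictMap (fun p => F p - F m) U)
        (DarbouxCaratheodory.restrictForm (DarbouxCaratheodory.canonicalForm n) V)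
        (DarbouxCaratheodory.restrictMap (DarbouxCaratheodory.xiMap n) V)
        φ (Equiv.setCongr hrange)) ∧
    (∃ (U : Opens M) (x : Fin n → M → ℝ),
      DarbouxCaratheodory.IsDarbouxCoordinates σ m U x (fun i p => F p i - F m i)) := by
  open DarbouxCaratheodory in
  obtain ⟨e, he, hme, hm0, hξ, hσ⟩ := exists_darboux_chart hF hm
  have hcomm : ∀ p : (⟨e.source, e.open_source⟩ : Opens M),
      restrictMap (xiMap n) ⟨e.target, e.open_target⟩ (chartDiffeomorph e he p) =
        restrictMap (fun p => F p - F m) ⟨e.source, e.open_source⟩ p := by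
    intro p
    ext i
    exact hξ p p.2 i
  refine ⟨⟨⟨e.source, e.open_source⟩, ⟨e.target, e.open_target⟩, hme, ?_,
    chartDiffeomorph e he, ?_, ?_, ?_, ?_, ?_, ?_⟩,
    ⟨e.source, e.open_source⟩, fun i p => e p (xIndex i), hme,
    ⟨e, he, rfl, hm0, fun p hp i => ⟨rfl, hξ p hp i⟩⟩, fun p hp => ?_⟩
  · exact hm0 ▸ e.map_source hme
  · rw [← funext hcomm]
    exact (chartDiffeomorph e he).surjective.range_comp
      (restrictMap (xiMap n) ⟨e.target, e.open_target⟩)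
  · exact Subtype.ext hm0
  · exact pullback_chartDiffeomorph e he hσ
  · exact isSmoothOnSubset_coe fun _ => rfl
  · exact isSmoothOnSubset_coe fun _ => rfl
  · exact hcomm
  · rw [hσ p hp]
    refine Finset.sum_congr rfl fun i _ => ?_
    -- The two functions agree only on the open chart domain, which suffices because the
    -- differential depends on the germ.
    have h : (fun q => e q (xiIndex i)) =ᶠ[nhds p] fun q => F q i - F m i := by
      filter_upwards [e.open_source.mem_nhds hp] with q hq using hξ q hq i
    congr 1
    exact h.mfderiv_eq
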